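/- For a probability distribution on $\mathbb R$ with distribution function $F$ let $F^{-1}(p)=\inf\{x: F(x)\ge p\}$, let $m=m(F)=F^{-1}(1/2)$ be the median, let $\mathrm{MAD}=\mathrm{MAD}(F)$ be the median of $|X-m|$ for $X\sim F$, and let $$\mathrm{RCV}_M=\mathrm{RCV}_M(F)=1.4826\times\frac{\mathrm{MAD}}{m}.$$ Suppose that $F$ is continuous near, and differentiable at, each of the points $m$, $m-\mathrm{MAD}$, $m+\mathrm{MAD}$, and write $f=F'$ there. Suppose that $f(m)>0$, that $C_1=f(m-\mathrm{MAD})+f(m+\mathrm{MAD})>0$, and that $m\neq 0$. Put $$C_3=f(m-\mathrm{MAD})-f(m+\mathrm{MAD}),\qquad C_2=C_3^2+4C_3f(m)\bigl(1-F(m+\mathrm{MAD})-F(m-\mathrm{MAD})\bigr),$$ $$\rho_1=\frac1{4f(m)^2},\qquad \rho_2=\frac1{4C_1^2}\Bigl[1+\frac{C_2}{f(m)^2}\Bigr],\qquad \rho_{12}=\frac1{4C_1f(m)}\Bigl[1-4F(m-\mathrm{MAD})+\frac{C_3}{f(m)}\Bigr].$$ Let $X_1,X_2,\dots$ be independent with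 distribution $F$ and let $F_n$ be the empirical distribution function of $X_1,\dots,X_n$. Then $\mathrm{MAD}>0$, the matrix $\Sigma=\begin{pmatrix}\rho_1&\rho_{12}\\ \rho_{12}&\rho_2\end{pmatrix}$ is positive semidefinite, and $$\sqrt n\,\bigl(m(F_n)-m,\ \mathrm{MAD}(F_n)-\mathrm{MAD}\bigr)^{\top}\ \xrightarrow{d}\ N(\mathbf 0,\Sigma),$$ so that $\rho_1$, $\rho_2$, $\rho_{12}$ are the asymptotic variances and the asymptotic covariance of the sample median and the sample MAD. Moreover the estimator $\mathrm{RCV}_M(F_n)$ of $\mathrm{RCV}_M$ has asymptotic variance $$\mathrm{ASV}=\mathrm{RCV}_M^2\left(\frac{\rho_1}{m^2}+\frac{\rho_2}{\mathrm{MAD}^2}-\frac{2\rho_{12}}{m\times \mathrm{MAD}}\right)\ \ge 0,$$ in both of the following senses: (i) $\sqrt n\,\bigl(\mathrm{RCV}_M(F_n)-\mathrm{RCV}_M(F)\bigr)\xrightarrow{d}N(0,\mathrm{ASV})$; (ii) with $\Delta_x$ the unit point mass at $x$, the influence function $\mathrm{IF}(x)=\lim_{\varepsilon\downarrow0}\varepsilon^{-1}\bigl[\mathrm{RCV}_M((1-\varepsilon)F+\varepsilon\Delta_x)-\mathrm{RCV}_M(F)\bigr]$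 exists for $F$-almost every $x$, is square integrable with respect to $F$, and satisfies $\mathrm E_F[\mathrm{IF}(X)^2]=\mathrm{ASV}$. -/

import Mathlib

open MeasureTheory ProbabilityTheory Filter Topology
open scoped ENNReal

noncomputable section

namespace RCVM

/-! Throughout, a distribution `F` on the real line is represented by the measure `μ`
with distribution function `cdf μ`. -/

/-- The quantile functional `F ↦ F⁻¹(p) = inf {x | p ≤ F x}`. -/
def quantile (μ : Measure ℝ) (p : ℝ) : ℝ := sInf {x : ℝ | p ≤ cdf μ x}

/-- The median `m = F⁻¹(1/2)`. -/
def median (μ : Measure ℝ) : ℝ := quantile μ (1 / 2)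

/-- The median absolute deviation: the median of the law of `|x - m|` for `x` with law `μ`. -/
def mad (μ : Measure ℝ) : ℝ := median (μ.map fun x => |x - median μ|)

/-- The robust coefficient of variation based on the median absolute deviation. -/
def rcv (μ : Measure ℝ) : ℝ := 1.4826 * (mad μ / median μ)

/-- The empirical distribution `F_n` of `x 0, …, x (n - 1)`. -/
def empirical (n : ℕ) (x : ℕ → ℝ) : Measure ℝ :=
  (n : ℝ≥0∞)⁻¹ • ∑ i ∈ Finset.range n, Measure.dirac (x i)

/-- The density at a point: the derivative of the distribution function. -/
def dens (μ : Measure ℝ) (x : ℝ) : ℝ := deriv (cdf μ) x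

/-- `C₁ = f(m - MAD) + f(m + MAD)`. -/
def C1 (μ : Measure ℝ) : ℝ := dens μ (median μ - mad μ) + dens μ (median μ + mad μ)

/-- `C₃ = f(m - MAD) - f(m + MAD)`. -/
def C3 (μ : Measure ℝ) : ℝ := dens μ (median μ - mad μ) - dens μ (median μ + mad μ)

/-- `C₂ = C₃² + 4 C₃ f(m) (1 - F(m + MAD) - F(m - MAD))`. -/
def C2 (μ : Measure ℝ) : ℝ :=
  C3 μ ^ 2 + 4 * C3 μ * dens μ (median μ) *
    (1 - cdf μ (median μ + mad μ) - cdf μ (median μ - mad μ))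

/-- `ρ₁`, the asymptotic variance of the sample median. -/
def rho1 (μ : Measure ℝ) : ℝ := 1 / (4 * dens μ (median μ) ^ 2)

/-- `ρ₂`, the asymptotic variance of the sample median absolute deviation. -/
def rho2 (μ : Measure ℝ) : ℝ :=
  1 / (4 * C1 μ ^ 2) * (1 + C2 μ / dens μ (median μ) ^ 2)

/-- `ρ₁₂`, the asymptotic covariance of the two. -/
def rho12 (μ : Measure ℝ) : ℝ :=
  1 / (4 * C1 μ * dens μ (median μ)) *
    (1 - 4 * cdf μ (median μ - mad μ) + C3 μ / dens μ (median μ))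

/-- The matrix with rows `(ρ₁, ρ₁₂)` and `(ρ₁₂, ρ₂)`. -/
def Sigma (μ : Measure ℝ) : Matrix (Fin 2) (Fin 2) ℝ :=
  !![rho1 μ, rho12 μ; rho12 μ, rho2 μ]

/-- The contaminated distribution `F_ε = (1 - ε) F + ε Δ_x` (for `0 ≤ ε ≤ 1`). -/
def contaminate (μ : Measure ℝ) (x ε : ℝ) : Measure ℝ :=
  ENNReal.ofReal (1 - ε) • μ + ENNReal.ofReal ε • Measure.dirac x

/-- The influence function of the functional `T` at `μ` exists at the point `x`
and has the value `L`. -/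
def HasInfluence (T : Measure ℝ → ℝ) (μ : Measure ℝ) (x L : ℝ) : Prop :=
  Tendsto (fun ε : ℝ => (T (contaminate μ x ε) - T μ) / ε) (𝓝[>] 0) (𝓝 L)

/-- `E_F[IF(X; T, F)²] = v`: the influence function of `T` exists at almost every point,
is square integrable, and has second moment `v`. -/
def HasASV (T : Measure ℝ → ℝ) (μ : Measure ℝ) (v : ℝ) : Prop :=
  ∃ φ : ℝ → ℝ, (∀ᵐ x ∂μ, HasInfluence T μ x (φ x)) ∧ MemLp φ 2 μ ∧ ∫ x, φ x ^ 2 ∂μ = v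

end RCVM

end

/-! The median solves F(x) = 1/2 and the MAD solves F(m + y) - F(m - y) = 1/2, so to first order
only the behaviour of F near the three nodes m, m - MAD, m + MAD matters. Suppose F is perturbed at
scale r and the perturbation, divided by r, is asymptotically a constant h(a) on windows of width
O(r) around each node a. Then both functionals expand linearly in these constants, with slopes f(m)
and C₁ in the denominators, and the ratio follows by the quotient rule. This deterministic expansion
(`IsLocalPerturbation.tendsto_median_sub`, `tendsto_mad_sub`, `tendsto_rcv_sub`) serves both senses
of asymptotic variance.

For contamination, r = ε and h is the centred indicator `bump`; this yields the influence function
off the nodes, which are not atoms. For sampling, r = 1/√n and h is the empirical process. Its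
increments over windows of width O(1/√n) vanish in probability by Chebyshev, so the rescaled error
of each estimator is a normalized sum of influence values plus o_P(1), and the central limit theorem
applies. Convergence in probability is encoded as a filter, so that the same expansion covers the
random case.

The variances come from the covariance F(a)(1 - F(b)), a ≤ b, of centred indicators, together with
F(m) = 1/2 and F(m + MAD) = F(m - MAD) + 1/2 (`integral_influence_sq`). -/

namespace RCVM

/-! ### Medians, the MAD and the distribution function of a fixed law -/

/-- Right continuity makes the infimum defining the median attained. All later bounds on medians
pass through this equivalence. -/
lemma median_le_iff (ν : Measure ℝ) (y : ℝ) : median ν ≤ y ↔ 1 / 2 ≤ cdf ν y := by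
  have hbdd : BddBelow {x : ℝ | 1 / 2 ≤ cdf ν x} := by
    obtain ⟨b, hb⟩ := ((tendsto_cdf_atBot ν).eventually_lt_const
      (by norm_num : (0 : ℝ) < 1 / 2)).exists
    exact ⟨b, fun x hx => le_of_not_gt fun h =>
      (hx.trans (monotone_cdf ν h.le)).not_gt hb⟩
  refine ⟨fun h => ?_, fun h => csInf_le hbdd h⟩
  by_contra! hlt
  obtain ⟨c, hc⟩ := ((tendsto_cdf_atTop ν).eventually_const_le
    (by norm_num : (1 / 2 : ℝ) < 1)).exists
  have hright : ∀ᶠ z in 𝓝[>] y, cdf ν z < 1 / 2 :=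
    (((cdf ν).right_continuous y).tendsto.mono_left
      (nhdsWithin_mono _ Set.Ioi_subset_Ici_self)).eventually_lt_const hlt
  obtain ⟨z, hz, hyz⟩ := (hright.and self_mem_nhdsWithin).exists
  have : z ≤ median ν := le_csInf ⟨c, hc⟩ fun x hx => le_of_not_gt fun h =>
    ((show 1 / 2 ≤ cdf ν x from hx).trans (monotone_cdf ν h.le)).not_gt hz
  exact (this.trans h).not_gt hyz

lemma half_le_cdf_median (ν : Measure ℝ) : 1 / 2 ≤ cdf ν (median ν) :=
  (median_le_iff ν _).1 le_rfl

lemma cdf_lt_half_of_lt_median {ν : Measure ℝ} {y : ℝ} (h : y < median ν) : cdf ν y < 1 / 2 :=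
  lt_of_not_ge fun h' => h.not_ge ((median_le_iff ν y).2 h')

lemma cdf_median_eq_half {ν : Measure ℝ} (hc : ContinuousAt (cdf ν) (median ν)) :
    cdf ν (median ν) = 1 / 2 := by
  refine le_antisymm (le_of_tendsto (hc.tendsto.mono_left nhdsWithin_le_nhds :
    Tendsto _ (𝓝[<] median ν) _) ?_) (half_le_cdf_median ν)
  filter_upwards [self_mem_nhdsWithin] with y hy using (cdf_lt_half_of_lt_median hy).le

/-- The event is a closed interval: its left endpoint is kept, so the mass of an open half-line is
subtracted rather than a value of the distribution function. -/
lemma cdf_map_abs_sub (ν : Measure ℝ) [IsProbabilityMeasure ν] (c : ℝ) {y : ℝ} (hy : 0 ≤ y) :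
    cdf (ν.map fun x => |x - c|) y = cdf ν (c + y) - ν.real (Set.Iio (c - y)) := by
  have hmeas : Measurable fun x : ℝ => |x - c| := by fun_prop
  have := Measure.isProbabilityMeasure_map (μ := ν) hmeas.aemeasurable
  rw [cdf_eq_real, cdf_eq_real, map_measureReal_apply hmeas measurableSet_Iic,
    ← measureReal_sdiff (Set.Iio_subset_Iic (by linarith)) measurableSet_Iio]
  congr 1
  ext x
  simp only [Set.mem_preimage, Set.mem_Iic, abs_le, Set.mem_sdiff, Set.mem_Iio, not_lt]
  constructor <;> rintro ⟨h, h'⟩ <;> constructor <;> linarith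

lemma cdf_map_abs_sub_of_neg (ν : Measure ℝ) [IsProbabilityMeasure ν] (c : ℝ) {y : ℝ}
    (hy : y < 0) : cdf (ν.map fun x => |x - c|) y = 0 := by
  have hmeas : Measurable fun x : ℝ => |x - c| := by fun_prop
  have := Measure.isProbabilityMeasure_map (μ := ν) hmeas.aemeasurable
  rw [cdf_eq_real, map_measureReal_apply hmeas measurableSet_Iic]
  convert measureReal_empty
  ext x
  simpa using hy.trans_le (abs_nonneg _)

lemma measureReal_Iio_le_cdf (ν : Measure ℝ) [IsProbabilityMeasure ν] {x y : ℝ} (h : x ≤ y) :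
    ν.real (Set.Iio x) ≤ cdf ν y := by
  rw [cdf_eq_real]
  exact measureReal_mono fun z hz => (lt_of_lt_of_le hz h).le

lemma cdf_le_measureReal_Iio (ν : Measure ℝ) [IsProbabilityMeasure ν] {x y : ℝ} (h : x < y) :
    cdf ν x ≤ ν.real (Set.Iio y) := by
  rw [cdf_eq_real]
  exact measureReal_mono fun z hz => lt_of_le_of_lt hz h

lemma measureReal_Iio_eq_cdf {ν : Measure ℝ} [IsProbabilityMeasure ν] {a : ℝ}
    (hc : ContinuousAt (cdf ν) a) : ν.real (Set.Iio a) = cdf ν a := by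
  refine le_antisymm (measureReal_Iio_le_cdf ν le_rfl) ?_
  refine le_of_tendsto (hc.tendsto.mono_left nhdsWithin_le_nhds : Tendsto _ (𝓝[<] a) _) ?_
  filter_upwards [self_mem_nhdsWithin] with y hy using cdf_le_measureReal_Iio ν hy

lemma measure_singleton_eq_zero {ν : Measure ℝ} [IsProbabilityMeasure ν] {a : ℝ}
    (hc : ContinuousAt (cdf ν) a) : ν {a} = 0 := by
  have h : ν.real (Set.Iic a \ Set.Iio a) = 0 := by
    rw [measureReal_sdiff Set.Iio_subset_Iic_self measurableSet_Iio, measureReal_Iio_eq_cdf hc,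
      cdf_eq_real, sub_self]
  rw [Set.Iic_sdiff_Iio_same] at h
  exact (measureReal_eq_zero_iff).1 h

/-- Since m is not an atom, the law of |x - m| gives no mass to (-∞, 0], so its median cannot lie
there. -/
lemma mad_pos {μ : Measure ℝ} [IsProbabilityMeasure μ]
    (hc : ContinuousAt (cdf μ) (median μ)) : 0 < mad μ := by
  have h := half_le_cdf_median (μ.map fun x => |x - median μ|)
  change 1 / 2 ≤ cdf _ (mad μ) at h
  by_contra! hd
  rcases hd.lt_or_eq with hd | hd
  · rw [cdf_map_abs_sub_of_neg μ _ hd] at h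
    norm_num at h
  · rw [hd, cdf_map_abs_sub μ _ le_rfl, sub_zero, add_zero, measureReal_Iio_eq_cdf hc,
      sub_self] at h
    norm_num at h

lemma cdf_add_mad_sub_cdf_sub_mad {μ : Measure ℝ} [IsProbabilityMeasure μ]
    (hc : ContinuousAt (cdf μ) (median μ))
    (hc₁ : ContinuousAt (cdf μ) (median μ - mad μ))
    (hc₂ : ContinuousAt (cdf μ) (median μ + mad μ)) :
    cdf μ (median μ + mad μ) - cdf μ (median μ - mad μ) = 1 / 2 := by
  have hd := mad_pos hc
  apply le_antisymm
  -- Below the MAD the mass of the interval is less than 1/2; let y increase to the MAD.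
  · have ht : Tendsto (fun y => cdf μ (median μ + y) - cdf μ (median μ - y)) (𝓝[<] mad μ)
        (𝓝 (cdf μ (median μ + mad μ) - cdf μ (median μ - mad μ))) := by
      refine Tendsto.mono_left (Tendsto.sub ?_ ?_) nhdsWithin_le_nhds
      · exact hc₂.tendsto.comp (Continuous.tendsto (by fun_prop) _)
      · exact hc₁.tendsto.comp (Continuous.tendsto (f := fun y => median μ - y) (by fun_prop) _)
    refine le_of_tendsto ht ?_
    filter_upwards [self_mem_nhdsWithin, mem_nhdsWithin_of_mem_nhds (lt_mem_nhds hd)]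
      with y hy hy0
    have h1 : cdf _ y < 1 / 2 := cdf_lt_half_of_lt_median hy
    rw [cdf_map_abs_sub μ _ (le_of_lt hy0)] at h1
    linarith [measureReal_Iio_le_cdf μ (le_refl (median μ - y))]
  · have h := half_le_cdf_median (μ.map fun x => |x - median μ|)
    change 1 / 2 ≤ cdf _ (mad μ) at h
    rwa [cdf_map_abs_sub μ _ hd.le, measureReal_Iio_eq_cdf hc₁] at h

/-! ### First-order expansion of the median, the MAD and their ratio -/

section LocalLimit

variable {ι : Type*} {l : Filter ι} {r : ι → ℝ}

/-- Pointwise convergence of rescaled monotone functions to an affine function allows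
for converging arguments. -/
lemma tendsto_rescaled_of_tendsto {G : ι → ℝ → ℝ} {a b h c u : ℝ} {x v : ι → ℝ}
    (hr : Tendsto r l (𝓝[>] 0))
    (hG : ∀ t, Tendsto (fun k => (G k (a + r k * t) - b) / r k) l (𝓝 (h + c * t)))
    (hx : Tendsto (fun k => (x k - a) / r k) l (𝓝 u))
    (hlow : ∀ᶠ k in l, ∀ y < x k, G k y ≤ v k) (hupp : ∀ᶠ k in l, ∀ y > x k, v k ≤ G k y) :
    Tendsto (fun k => (v k - b) / r k) l (𝓝 (h + c * u)) := by
  have hr0 : ∀ᶠ k in l, 0 < r k := hr.eventually self_mem_nhdsWithin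
  have hcont : Continuous fun t : ℝ => h + c * t := by fun_prop
  rw [tendsto_order]
  constructor
  · intro z hz
    -- For fixed t < u near u, the point a + r t is eventually below x, so `hlow` bounds v by the
    -- known limit at t. Only one-sided bounds on v are used, so v may also be a left limit of G.
    have hev : ∀ᶠ t in 𝓝[<] u, z < h + c * t :=
      (hcont.tendsto u).mono_left nhdsWithin_le_nhds |>.eventually_const_lt hz
    obtain ⟨t, ht, htu⟩ := (hev.and self_mem_nhdsWithin).exists
    filter_upwards [hr0, hlow, (hG t).eventually_const_lt ht, hx.eventually_const_lt htu]
      with k hk hlk hGk hxk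
    refine hGk.trans_le ?_
    rw [lt_div_iff₀ hk] at hxk
    gcongr
    exact hlk _ (by linarith)
  · intro z hz
    have hev : ∀ᶠ t in 𝓝[>] u, h + c * t < z :=
      (hcont.tendsto u).mono_left nhdsWithin_le_nhds |>.eventually_lt_const hz
    obtain ⟨t, ht, htu⟩ := (hev.and self_mem_nhdsWithin).exists
    filter_upwards [hr0, hupp, (hG t).eventually_lt_const ht, hx.eventually_lt_const htu]
      with k hk hlk hGk hxk
    refine lt_of_le_of_lt ?_ hGk
    rw [div_lt_iff₀ hk] at hxk
    gcongr
    exact hlk _ (by linarith)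

/-- The limit is the zero of the affine function h + c t: on either side of it the rescaled
distribution function has eventually the right sign, which locates the median. -/
lemma tendsto_rescaled_median {ν : ι → Measure ℝ} {a h c : ℝ} (hc : 0 < c)
    (hr : Tendsto r l (𝓝[>] 0))
    (hG : ∀ t, Tendsto (fun k => (cdf (ν k) (a + r k * t) - 1 / 2) / r k) l (𝓝 (h + c * t))) :
    Tendsto (fun k => (median (ν k) - a) / r k) l (𝓝 (-h / c)) := by
  have hr0 : ∀ᶠ k in l, 0 < r k := hr.eventually self_mem_nhdsWithin
  rw [tendsto_order]
  constructor
  · intro z hz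
    rw [lt_div_iff₀ hc] at hz
    filter_upwards [hr0, (hG z).eventually_lt_const (by linarith : h + c * z < 0)] with k hk hGk
    rw [div_lt_iff₀ hk, zero_mul, sub_neg] at hGk
    have := lt_of_not_ge fun h' => hGk.not_ge ((median_le_iff _ _).1 h')
    rw [lt_div_iff₀ hk]
    linarith
  · intro z hz
    -- An intermediate point is needed because `median_le_iff` bounds the median only non-strictly.
    obtain ⟨w, hw, hwz⟩ := exists_between hz
    rw [div_lt_iff₀ hc] at hw
    filter_upwards [hr0, (hG w).eventually_const_lt (by linarith : 0 < h + c * w)] with k hk hGk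
    rw [lt_div_iff₀ hk, zero_mul, sub_pos] at hGk
    have := (median_le_iff _ _).2 hGk.le
    refine lt_of_le_of_lt ?_ hwz
    rw [div_le_iff₀ hk]
    linarith

lemma tendsto_of_rescaled {x : ι → ℝ} {a u : ℝ} (hr : Tendsto r l (𝓝[>] 0))
    (hx : Tendsto (fun k => (x k - a) / r k) l (𝓝 u)) : Tendsto x l (𝓝 a) := by
  have h := (hx.mul (hr.mono_right nhdsWithin_le_nhds)).add_const a
  rw [mul_zero, zero_add] at h
  refine h.congr' ?_
  filter_upwards [hr.eventually self_mem_nhdsWithin] with k hk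
  have : r k ≠ 0 := ne_of_gt hk
  field_simp
  ring

/-- The distribution function of the absolute deviation at d + r s is a difference of two values at
the moving points median ± (d + r s). Its rescaled limit is affine in s with slope fm + fp, so the
expansion of the median applies again. -/
lemma tendsto_rescaled_mad {ν : ι → Measure ℝ} {m d u p q fp fm hp hm : ℝ} (hd : 0 < d)
    (hpq : p - q = 1 / 2) (hC : 0 < fm + fp) (hν : ∀ᶠ k in l, IsProbabilityMeasure (ν k))
    (hr : Tendsto r l (𝓝[>] 0))
    (hmed : Tendsto (fun k => (median (ν k) - m) / r k) l (𝓝 u))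
    (hGp : ∀ t, Tendsto (fun k => (cdf (ν k) (m + d + r k * t) - p) / r k) l (𝓝 (hp + fp * t)))
    (hGm : ∀ t, Tendsto (fun k => (cdf (ν k) (m - d + r k * t) - q) / r k) l
      (𝓝 (hm + fm * t))) :
    Tendsto (fun k => (mad (ν k) - d) / r k) l (𝓝 (((fm - fp) * u - (hp - hm)) / (fm + fp))) := by
  have hr0 : ∀ᶠ k in l, 0 < r k := hr.eventually self_mem_nhdsWithin
  have key : ∀ s, Tendsto (fun k => (cdf ((ν k).map fun x => |x - median (ν k)|) (d + r k * s)
      - 1 / 2) / r k) l (𝓝 ((hp - hm - (fm - fp) * u) + (fm + fp) * s)) := by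
    intro s
    have h1 : Tendsto (fun k => (cdf (ν k) (median (ν k) + (d + r k * s)) - p) / r k) l
        (𝓝 (hp + fp * (u + s))) := by
      refine tendsto_rescaled_of_tendsto hr hGp
        (x := fun k => median (ν k) + (d + r k * s)) ?_ ?_ ?_
      · refine (hmed.add_const s).congr' ?_
        filter_upwards [hr0] with k hk
        field_simp
        ring
      · exact .of_forall fun k y hy => monotone_cdf _ hy.le
      · exact .of_forall fun k y hy => monotone_cdf _ (le_of_lt hy)
    have h2 : Tendsto (fun k => ((ν k).real (Set.Iio (median (ν k) - (d + r k * s))) - q) / r k) l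
        (𝓝 (hm + fm * (u - s))) := by
      refine tendsto_rescaled_of_tendsto hr hGm
        (x := fun k => median (ν k) - (d + r k * s)) ?_ ?_ ?_
      · refine (hmed.sub_const s).congr' ?_
        filter_upwards [hr0] with k hk
        field_simp
        ring
      · filter_upwards [hν] with k _ y hy using cdf_le_measureReal_Iio _ hy
      · filter_upwards [hν] with k _ y hy using measureReal_Iio_le_cdf _ (le_of_lt hy)
    have hpos : ∀ᶠ k in l, 0 < d + r k * s := by
      have : Tendsto (fun k => d + r k * s) l (𝓝 (d + 0 * s)) :=
        ((hr.mono_right nhdsWithin_le_nhds).mul_const s).const_add d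
      exact this.eventually_const_lt (by simpa using hd)
    have h3 := h1.sub h2
    rw [show hp + fp * (u + s) - (hm + fm * (u - s))
      = (hp - hm - (fm - fp) * u) + (fm + fp) * s by ring] at h3
    refine h3.congr' ?_
    filter_upwards [hpos, hν] with k hk _
    rw [cdf_map_abs_sub _ _ hk.le, ← hpq]
    ring
  have := tendsto_rescaled_median hC hr key
  rwa [neg_sub] at this

lemma tendsto_rescaled_rcv {ν : ι → Measure ℝ} {m d u w : ℝ} (hm : m ≠ 0)
    (hr : Tendsto r l (𝓝[>] 0))
    (hmed : Tendsto (fun k => (median (ν k) - m) / r k) l (𝓝 u))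
    (hmad : Tendsto (fun k => (mad (ν k) - d) / r k) l (𝓝 w)) :
    Tendsto (fun k => (rcv (ν k) - 1.4826 * (d / m)) / r k) l
      (𝓝 (1.4826 * (w / m - d * u / m ^ 2))) := by
  have hmk := tendsto_of_rescaled hr hmed
  have h := (((hmad.mul_const m).sub (hmed.const_mul d)).div (hmk.mul_const m)
    (mul_ne_zero hm hm)).const_mul (1.4826 : ℝ)
  rw [show w / m - d * u / m ^ 2 = (w * m - d * u) / (m * m) by field_simp]
  refine h.congr' ?_
  filter_upwards [hr.eventually self_mem_nhdsWithin, hmk.eventually_ne hm] with k hk hk'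
  have : r k ≠ 0 := ne_of_gt hk
  simp only [rcv, Pi.div_apply]
  field_simp
  ring

end LocalLimit

/-! ### Differentiability along local perturbations -/

/-- The regularity conditions on the distribution function near the median and the points
at distance `MAD` from it. -/
structure Regular (μ : Measure ℝ) : Prop where
  diff_median : DifferentiableAt ℝ (cdf μ) (median μ)
  diff_sub : DifferentiableAt ℝ (cdf μ) (median μ - mad μ)
  diff_add : DifferentiableAt ℝ (cdf μ) (median μ + mad μ)
  dens_pos : 0 < dens μ (median μ)
  C1_pos : 0 < C1 μ

/-- The points at which the local behaviour of the distribution function matters. -/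
def nodes (μ : Measure ℝ) : Set ℝ := {median μ, median μ - mad μ, median μ + mad μ}

/-- The derivative of the median at `μ`, in terms of the perturbation of the
distribution function. -/
noncomputable def medianDeriv (μ : Measure ℝ) (h : ℝ → ℝ) : ℝ :=
  -h (median μ) / dens μ (median μ)

/-- The derivative of the median absolute deviation at `μ`, in terms of the perturbation of the
distribution function. -/
noncomputable def madDeriv (μ : Measure ℝ) (h : ℝ → ℝ) : ℝ :=
  (C3 μ * medianDeriv μ h - (h (median μ + mad μ) - h (median μ - mad μ))) / C1 μ

/-- The derivative of the robust coefficient of variation at `μ`, in terms of the perturbation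
of the distribution function. -/
noncomputable def rcvDeriv (μ : Measure ℝ) (h : ℝ → ℝ) : ℝ :=
  1.4826 * (madDeriv μ h / median μ - mad μ * medianDeriv μ h / median μ ^ 2)

namespace Regular

variable {μ : Measure ℝ} (hμ : Regular μ)
include hμ

lemma differentiableAt {a : ℝ} (ha : a ∈ nodes μ) : DifferentiableAt ℝ (cdf μ) a := by
  rcases ha with rfl | rfl | rfl
  exacts [hμ.diff_median, hμ.diff_sub, hμ.diff_add]

lemma continuousAt {a : ℝ} (ha : a ∈ nodes μ) : ContinuousAt (cdf μ) a :=
  (hμ.differentiableAt ha).continuousAt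

lemma cdf_median : cdf μ (median μ) = 1 / 2 :=
  cdf_median_eq_half hμ.diff_median.continuousAt

variable [IsProbabilityMeasure μ]

lemma mad_pos : 0 < mad μ := RCVM.mad_pos hμ.diff_median.continuousAt

lemma cdf_add_mad : cdf μ (median μ + mad μ) = cdf μ (median μ - mad μ) + 1 / 2 := by
  linarith [cdf_add_mad_sub_cdf_sub_mad hμ.diff_median.continuousAt hμ.diff_sub.continuousAt
    hμ.diff_add.continuousAt]

end Regular

/-- The measures `ν k` are perturbations of `μ` at scale `r k`: after rescaling the difference of
the distribution functions is asymptotically the constant `h k a` in the vicinity of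
each node `a`, and remains bounded. -/
structure IsLocalPerturbation {ι : Type*} (μ : Measure ℝ) (l : Filter ι) (r : ι → ℝ)
    (ν : ι → Measure ℝ) (h : ι → ℝ → ℝ) : Prop where
  scale : Tendsto r l (𝓝[>] 0)
  prob : ∀ᶠ k in l, IsProbabilityMeasure (ν k)
  bounded : ∃ K, ∀ a ∈ nodes μ, ∀ᶠ k in l, |h k a| ≤ K
  tendsto : ∀ a ∈ nodes μ, ∀ t, Tendsto
    (fun k => (cdf (ν k) (a + r k * t) - cdf μ a) / r k - h k a) l (𝓝 (dens μ a * t))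

namespace IsLocalPerturbation

variable {ι : Type*} {μ : Measure ℝ} {l : Filter ι} {r : ι → ℝ}
  {ν : ι → Measure ℝ} {h : ι → ℝ → ℝ}

lemma mono {l' : Filter ι} (hν : IsLocalPerturbation μ l r ν h) (hl : l' ≤ l) :
    IsLocalPerturbation μ l' r ν h where
  scale := hν.scale.mono_left hl
  prob := hν.prob.filter_mono hl
  bounded := hν.bounded.imp fun _ hK a ha => (hK a ha).filter_mono hl
  tendsto a ha t := (hν.tendsto a ha t).mono_left hl

/-- Bounded reals converge along any ultrafilter, by compactness. -/
lemma exists_tendsto {U : Ultrafilter ι} (hν : IsLocalPerturbation μ U r ν h) :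
    ∃ w : ℝ → ℝ, ∀ a ∈ nodes μ, Tendsto (fun k => h k a) U (𝓝 (w a)) := by
  obtain ⟨K, hK⟩ := hν.bounded
  have : ∀ a, ∃ w, a ∈ nodes μ → Tendsto (fun k => h k a) U (𝓝 w) := by
    intro a
    by_cases ha : a ∈ nodes μ
    · obtain ⟨w, -, hw⟩ := (isCompact_Icc (a := -K) (b := K)).ultrafilter_le_nhds
        (U.map fun k => h k a) (by
          rw [Ultrafilter.coe_map, le_principal_iff, mem_map]
          filter_upwards [hK a ha] with k hk using abs_le.1 hk)
      exact ⟨w, fun _ => hw⟩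
    · exact ⟨0, fun h' => absurd h' ha⟩
  choose w hw using this
  exact ⟨w, hw⟩

lemma tendsto_medianDeriv {w : ℝ → ℝ}
    (hw : ∀ a ∈ nodes μ, Tendsto (fun k => h k a) l (𝓝 (w a))) :
    Tendsto (fun k => medianDeriv μ (h k)) l (𝓝 (medianDeriv μ w)) :=
  (hw _ (by simp [nodes])).neg.div_const _

lemma tendsto_madDeriv {w : ℝ → ℝ}
    (hw : ∀ a ∈ nodes μ, Tendsto (fun k => h k a) l (𝓝 (w a))) :
    Tendsto (fun k => madDeriv μ (h k)) l (𝓝 (madDeriv μ w)) :=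
  (((tendsto_medianDeriv hw).const_mul _).sub
    ((hw _ (by simp [nodes])).sub (hw _ (by simp [nodes])))).div_const _

variable [IsProbabilityMeasure μ]

lemma tendsto_of_tendsto (hν : IsLocalPerturbation μ l r ν h) (hμ : Regular μ) {w : ℝ → ℝ}
    (hw : ∀ a ∈ nodes μ, Tendsto (fun k => h k a) l (𝓝 (w a))) :
    Tendsto (fun k => (median (ν k) - median μ) / r k) l (𝓝 (medianDeriv μ w)) ∧
    Tendsto (fun k => (mad (ν k) - mad μ) / r k) l (𝓝 (madDeriv μ w)) := by
  have hG : ∀ a ∈ nodes μ, ∀ t, Tendsto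
      (fun k => (cdf (ν k) (a + r k * t) - cdf μ a) / r k) l (𝓝 (w a + dens μ a * t)) := by
    intro a ha t
    simpa [add_comm] using (hν.tendsto a ha t).add (hw a ha)
  have hmed : Tendsto (fun k => (median (ν k) - median μ) / r k) l (𝓝 (medianDeriv μ w)) := by
    refine tendsto_rescaled_median hμ.dens_pos hν.scale ?_
    rw [← hμ.cdf_median]
    exact hG _ (by simp [nodes])
  refine ⟨hmed, ?_⟩
  exact tendsto_rescaled_mad hμ.mad_pos (by rw [hμ.cdf_add_mad, add_sub_cancel_left]) hμ.C1_pos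
    hν.prob hν.scale hmed (hG _ (by simp [nodes])) (hG _ (by simp [nodes]))

/-- The perturbations `h k` are only bounded, as the empirical process will be. Along each
ultrafilter they converge, and both terms then have the same limit. -/
lemma tendsto_median_sub (hν : IsLocalPerturbation μ l r ν h) (hμ : Regular μ) :
    Tendsto (fun k => (median (ν k) - median μ) / r k - medianDeriv μ (h k)) l (𝓝 0) := by
  refine tendsto_iff_ultrafilter _ _ _ |>.2 fun U hU => ?_
  obtain ⟨w, hw⟩ := (hν.mono hU).exists_tendsto
  simpa using ((hν.mono hU).tendsto_of_tendsto hμ hw).1.sub (tendsto_medianDeriv hw)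

lemma tendsto_mad_sub (hν : IsLocalPerturbation μ l r ν h) (hμ : Regular μ) :
    Tendsto (fun k => (mad (ν k) - mad μ) / r k - madDeriv μ (h k)) l (𝓝 0) := by
  refine tendsto_iff_ultrafilter _ _ _ |>.2 fun U hU => ?_
  obtain ⟨w, hw⟩ := (hν.mono hU).exists_tendsto
  simpa using ((hν.mono hU).tendsto_of_tendsto hμ hw).2.sub (tendsto_madDeriv hw)

lemma tendsto_rcv_sub (hν : IsLocalPerturbation μ l r ν h) (hμ : Regular μ)
    (hm : median μ ≠ 0) :
    Tendsto (fun k => (rcv (ν k) - rcv μ) / r k - rcvDeriv μ (h k)) l (𝓝 0) := by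
  refine tendsto_iff_ultrafilter _ _ _ |>.2 fun U hU => ?_
  obtain ⟨w, hw⟩ := (hν.mono hU).exists_tendsto
  have h1 := (hν.mono hU).tendsto_of_tendsto hμ hw
  have h2 := tendsto_rescaled_rcv hm (hν.mono hU).scale h1.1 h1.2
  have h3 := (((tendsto_madDeriv hw).div_const (median μ)).sub
    (((tendsto_medianDeriv hw).const_mul (mad μ)).div_const (median μ ^ 2))).const_mul
      (1.4826 : ℝ)
  simpa [rcv, rcvDeriv] using h2.sub h3

end IsLocalPerturbation

/-! ### Contamination and the influence function -/

/-- The centred distribution function of the unit mass at `x`. -/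
noncomputable def bump (μ : Measure ℝ) (x a : ℝ) : ℝ := (Set.Iic a).indicator 1 x - cdf μ a

lemma abs_bump_le {μ : Measure ℝ} (x a : ℝ) : |bump μ x a| ≤ 1 := by
  have h0 := cdf_nonneg μ a
  have h1 := cdf_le_one μ a
  by_cases h : x ≤ a <;> simp only [bump, Set.mem_Iic, h, Set.indicator_of_mem,
    not_false_eq_true, Set.indicator_of_notMem, Pi.one_apply] <;>
    rw [abs_le] <;> constructor <;> linarith

lemma tendsto_cdf_rescaled {ι : Type*} {l : Filter ι} {r : ι → ℝ} {μ : Measure ℝ} {a : ℝ}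
    (ha : DifferentiableAt ℝ (cdf μ) a) (hr : Tendsto r l (𝓝[>] 0)) (t : ℝ) :
    Tendsto (fun k => (cdf μ (a + r k * t) - cdf μ a) / r k) l (𝓝 (dens μ a * t)) := by
  have h1 : HasDerivAt (fun s => cdf μ (a + s * t)) (dens μ a * t) 0 := by
    have h2 : HasDerivAt (fun s : ℝ => a + s * t) t 0 := by
      simpa using ((hasDerivAt_id (0 : ℝ)).mul_const t).const_add a
    have h3 : HasDerivAt (cdf μ) (dens μ a) (a + 0 * t) := by
      rw [zero_mul, add_zero]
      exact ha.hasDerivAt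
    exact h3.comp (0 : ℝ) h2
  have h4 := (h1.tendsto_slope_zero).comp (hr.mono_right (nhdsWithin_mono _ fun x hx => ne_of_gt hx))
  refine h4.congr fun k => ?_
  simp [div_eq_inv_mul]

lemma isProbabilityMeasure_contaminate (μ : Measure ℝ) [IsProbabilityMeasure μ] (x : ℝ) {ε : ℝ}
    (h0 : 0 ≤ ε) (h1 : ε ≤ 1) : IsProbabilityMeasure (contaminate μ x ε) := by
  constructor
  simp only [contaminate, Measure.coe_add, Measure.coe_smul, Pi.add_apply, Pi.smul_apply,
    measure_univ, smul_eq_mul, mul_one]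
  rw [← ENNReal.ofReal_add (by linarith) h0]
  simp

lemma cdf_contaminate (μ : Measure ℝ) [IsProbabilityMeasure μ] (x : ℝ) {ε : ℝ}
    (h0 : 0 ≤ ε) (h1 : ε ≤ 1) (y : ℝ) :
    cdf (contaminate μ x ε) y = cdf μ y + ε * bump μ x y := by
  have := isProbabilityMeasure_contaminate μ x h0 h1
  rw [cdf_eq_real, cdf_eq_real μ, bump, cdf_eq_real μ, contaminate,
    measureReal_add_apply
    (by rw [Measure.smul_apply, smul_eq_mul]; finiteness)
    (by rw [Measure.smul_apply, smul_eq_mul]; finiteness), measureReal_ennreal_smul_apply,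
    measureReal_ennreal_smul_apply,
    ENNReal.toReal_ofReal (by linarith), ENNReal.toReal_ofReal h0, measureReal_def
    (Measure.dirac x), Measure.dirac_apply' _ measurableSet_Iic]
  by_cases h : x ≤ y
  · simp [h]; ring
  · simp [h]; ring

/-- Off the nodes, the indicator in `bump` is locally constant near each node, so the error is the
difference quotient of the distribution function minus an increment tending to zero by continuity.
-/
lemma isLocalPerturbation_contaminate {μ : Measure ℝ} [IsProbabilityMeasure μ] (hμ : Regular μ)
    {x : ℝ} (hx : x ∉ nodes μ) :
    IsLocalPerturbation μ (𝓝[>] 0) id (contaminate μ x) (fun _ => bump μ x) where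
  scale := tendsto_id
  prob := by
    filter_upwards [Ioo_mem_nhdsGT (zero_lt_one (α := ℝ))] with ε hε
    exact isProbabilityMeasure_contaminate μ x hε.1.le hε.2.le
  bounded := ⟨1, fun a _ => .of_forall fun _ => abs_bump_le x a⟩
  tendsto a ha t := by
    have hxa : x ≠ a := fun h => hx (h ▸ ha)
    have hlim : Tendsto (fun ε : ℝ => a + ε * t) (𝓝[>] 0) (𝓝 a) := by
      have : Tendsto (fun ε : ℝ => a + ε * t) (𝓝 0) (𝓝 (a + 0 * t)) :=
        Continuous.tendsto (by fun_prop) _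
      simpa using this.mono_left nhdsWithin_le_nhds
    have hind : ∀ᶠ ε : ℝ in 𝓝[>] 0,
        (Set.Iic (a + ε * t)).indicator (1 : ℝ → ℝ) x = (Set.Iic a).indicator 1 x := by
      rcases hxa.lt_or_gt with h | h
      · filter_upwards [hlim.eventually_const_lt h] with ε hε
        simp [h.le, hε.le]
      · filter_upwards [hlim.eventually_lt_const h] with ε hε
        simp [not_le.2 h, not_le.2 hε]
    have h1 := (tendsto_cdf_rescaled (hμ.differentiableAt ha) tendsto_id t).sub
      (((hμ.continuousAt ha).tendsto.comp hlim).sub_const (cdf μ a))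
    rw [sub_self, sub_zero] at h1
    refine h1.congr' ?_
    filter_upwards [hind, Ioo_mem_nhdsGT (zero_lt_one (α := ℝ))] with ε hε hε'
    have h0 : ε ≠ 0 := hε'.1.ne'
    rw [cdf_contaminate μ x hε'.1.le hε'.2.le, bump, bump]
    simp only [id, Function.comp, hε]
    field_simp
    ring

lemma hasInfluence_rcv {μ : Measure ℝ} [IsProbabilityMeasure μ] (hμ : Regular μ)
    (hm : median μ ≠ 0) {x : ℝ} (hx : x ∉ nodes μ) :
    HasInfluence rcv μ x (rcvDeriv μ (bump μ x)) := by
  have := ((isLocalPerturbation_contaminate hμ hx).tendsto_rcv_sub hμ hm).add_const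
    (rcvDeriv μ (bump μ x))
  simpa [HasInfluence] using this

lemma ae_notMem_nodes {μ : Measure ℝ} [IsProbabilityMeasure μ] (hμ : Regular μ) :
    ∀ᵐ x ∂μ, x ∉ nodes μ := by
  have hz : ∀ a ∈ nodes μ, ∀ᵐ x ∂μ, x ≠ a := fun a ha =>
    measure_eq_zero_iff_ae_notMem.1 (measure_singleton_eq_zero (hμ.continuousAt ha))
  filter_upwards [hz _ (Or.inl rfl), hz _ (Or.inr (Or.inl rfl)), hz _ (Or.inr (Or.inr rfl))]
    with x h1 h2 h3
  simp [nodes, h1, h2, h3]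

/-! ### Second moments of the influence functions -/

section Moments

variable {μ : Measure ℝ}

@[fun_prop]
lemma measurable_bump (a : ℝ) : Measurable fun x => bump μ x a :=
  (measurable_one.indicator measurableSet_Iic).sub_const _

/-- A linear combination of the derivatives of the median and of the median absolute deviation,
evaluated at a unit mass. -/
noncomputable def influence (μ : Measure ℝ) (s t x : ℝ) : ℝ :=
  s * medianDeriv μ (bump μ x) + t * madDeriv μ (bump μ x)

/-- Writing the influence as a combination of three centred indicators reduces its moments to their
covariances. -/
lemma influence_eq (s t x : ℝ) : influence μ s t x =
    -((s + t * C3 μ / C1 μ) / dens μ (median μ)) * bump μ x (median μ)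
      + t / C1 μ * bump μ x (median μ - mad μ) + -(t / C1 μ) * bump μ x (median μ + mad μ) := by
  simp only [influence, medianDeriv, madDeriv]
  ring

@[fun_prop]
lemma measurable_influence (s t : ℝ) : Measurable (influence μ s t) := by
  simp_rw [funext (influence_eq (μ := μ) s t)]
  fun_prop

lemma rcvDeriv_bump (x : ℝ) : rcvDeriv μ (bump μ x)
    = influence μ (-1.4826 * mad μ / median μ ^ 2) (1.4826 / median μ) x := by
  simp only [rcvDeriv, influence]
  ring

variable [IsProbabilityMeasure μ]

lemma memLp_bump (a : ℝ) (p : ℝ≥0∞) : MemLp (fun x => bump μ x a) p μ :=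
  .of_bound (by fun_prop) 1 (.of_forall fun x => abs_bump_le x a)

lemma integrable_bump (a : ℝ) : Integrable (fun x => bump μ x a) μ :=
  memLp_one_iff_integrable.1 (memLp_bump a 1)

lemma integrable_bump_mul_bump (a b : ℝ) : Integrable (fun x => bump μ x a * bump μ x b) μ :=
  (memLp_bump a 2).integrable_mul (memLp_bump b 2)

lemma integral_bump (a : ℝ) : ∫ x, bump μ x a ∂μ = 0 := by
  have hi : Integrable ((Set.Iic a).indicator (1 : ℝ → ℝ)) μ :=
    (integrable_const (1 : ℝ)).indicator measurableSet_Iic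
  simp only [bump]
  rw [integral_sub hi (integrable_const _), integral_indicator_one measurableSet_Iic,
    cdf_eq_real]
  simp

lemma integral_bump_mul_bump {a b : ℝ} (hab : a ≤ b) :
    ∫ x, bump μ x a * bump μ x b ∂μ = cdf μ a * (1 - cdf μ b) := by
  have hi : Integrable ((Set.Iic a).indicator (1 : ℝ → ℝ)) μ :=
    (integrable_const (1 : ℝ)).indicator measurableSet_Iic
  -- For a ≤ b the product of the two indicators is the indicator at a.
  have heq : ∀ x, bump μ x a * bump μ x b
      = (1 - cdf μ b) * (Set.Iic a).indicator 1 x - cdf μ a * bump μ x b := by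
    intro x
    by_cases h : x ≤ a
    · simp [bump, h, h.trans hab]; ring
    · simp [bump, h]
  simp_rw [heq]
  rw [integral_sub (hi.const_mul _) ((integrable_bump b).const_mul _), integral_const_mul,
    integral_const_mul, integral_indicator_one measurableSet_Iic, integral_bump, ← cdf_eq_real]
  ring

lemma memLp_influence (s t : ℝ) : MemLp (influence μ s t) 2 μ := by
  simp_rw [funext (influence_eq (μ := μ) s t)]
  exact (((memLp_bump _ 2).const_mul _).add ((memLp_bump _ 2).const_mul _)).add
    ((memLp_bump _ 2).const_mul _)

lemma integral_influence (s t : ℝ) : ∫ x, influence μ s t x ∂μ = 0 := by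
  simp_rw [influence_eq]
  have hi (c a : ℝ) : Integrable (fun x => c * bump μ x a) μ := (integrable_bump a).const_mul c
  rw [integral_add (by fun_prop) (hi _ _), integral_add (hi _ _) (hi _ _)]
  simp only [integral_const_mul, integral_bump, mul_zero, add_zero]

lemma integral_bump_combination_sq (c₀ c₁ c₂ m₀ m₁ m₂ : ℝ) :
    ∫ x, (c₀ * bump μ x m₀ + c₁ * bump μ x m₁ + c₂ * bump μ x m₂) ^ 2 ∂μ =
      c₀ ^ 2 * ∫ x, bump μ x m₀ * bump μ x m₀ ∂μ + c₁ ^ 2 * ∫ x, bump μ x m₁ * bump μ x m₁ ∂μ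
      + c₂ ^ 2 * ∫ x, bump μ x m₂ * bump μ x m₂ ∂μ
      + 2 * c₀ * c₁ * ∫ x, bump μ x m₁ * bump μ x m₀ ∂μ
      + 2 * c₀ * c₂ * ∫ x, bump μ x m₀ * bump μ x m₂ ∂μ
      + 2 * c₁ * c₂ * ∫ x, bump μ x m₁ * bump μ x m₂ ∂μ := by
  have hi (c a b : ℝ) : Integrable (fun x => c * (bump μ x a * bump μ x b)) μ :=
    (integrable_bump_mul_bump a b).const_mul c
  simp_rw [← integral_const_mul]
  rw [← integral_add (hi _ _ _) (hi _ _ _), ← integral_add (by fun_prop) (hi _ _ _),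
    ← integral_add (by fun_prop) (hi _ _ _), ← integral_add (by fun_prop) (hi _ _ _),
    ← integral_add (by fun_prop) (hi _ _ _)]
  congr 1 with x
  ring

lemma integral_influence_sq (hμ : Regular μ) (s t : ℝ) :
    ∫ x, influence μ s t x ^ 2 ∂μ
      = s ^ 2 * rho1 μ + 2 * s * t * rho12 μ + t ^ 2 * rho2 μ := by
  have hd := hμ.mad_pos
  have hf := hμ.dens_pos.ne'
  have hC := hμ.C1_pos.ne'
  simp_rw [influence_eq]
  rw [integral_bump_combination_sq, integral_bump_mul_bump le_rfl, integral_bump_mul_bump le_rfl,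
    integral_bump_mul_bump le_rfl, integral_bump_mul_bump (by linarith),
    integral_bump_mul_bump (by linarith), integral_bump_mul_bump (by linarith), hμ.cdf_median,
    hμ.cdf_add_mad, rho1, rho12, rho2, C2, hμ.cdf_add_mad]
  field_simp
  ring

/-- The quadratic form of `Sigma` is the second moment of an influence function. -/
lemma posSemidef_Sigma (hμ : Regular μ) : (Sigma μ).PosSemidef := by
  refine Matrix.PosSemidef.of_dotProduct_mulVec_nonneg ?_ fun x => ?_
  · ext i j
    fin_cases i <;> fin_cases j <;> simp [Sigma]
  · have h : 0 ≤ ∫ y, influence μ (x 0) (x 1) y ^ 2 ∂μ := integral_nonneg fun y => sq_nonneg _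
    rw [integral_influence_sq hμ] at h
    simp only [Sigma, dotProduct, Matrix.mulVec, Fin.sum_univ_two, Pi.star_apply, star_trivial,
      Matrix.of_apply, Matrix.cons_val_zero, Matrix.cons_val_one]
    simp
    linarith

lemma integral_rcvDeriv_bump_sq (hμ : Regular μ) (hm : median μ ≠ 0) :
    ∫ x, rcvDeriv μ (bump μ x) ^ 2 ∂μ = rcv μ ^ 2 * (rho1 μ / median μ ^ 2
      + rho2 μ / mad μ ^ 2 - 2 * rho12 μ / (median μ * mad μ)) := by
  simp_rw [rcvDeriv_bump]
  have hd := hμ.mad_pos.ne'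
  rw [integral_influence_sq hμ, rcv]
  field_simp
  ring

lemma hasASV_rcv (hμ : Regular μ) (hm : median μ ≠ 0) :
    HasASV rcv μ (rcv μ ^ 2 * (rho1 μ / median μ ^ 2
      + rho2 μ / mad μ ^ 2 - 2 * rho12 μ / (median μ * mad μ))) := by
  refine ⟨fun x => rcvDeriv μ (bump μ x), ?_, ?_, integral_rcvDeriv_bump_sq hμ hm⟩
  · filter_upwards [ae_notMem_nodes hμ] with x hx using hasInfluence_rcv hμ hm hx
  · simp_rw [rcvDeriv_bump]
    exact memLp_influence _ _

end Moments

/-! ### Convergence in probability as a filter -/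

section InProbability

variable {Ω : Type*} [MeasurableSpace Ω]

/-- Convergence along this filter is convergence in probability. -/
def inProbability (P : Measure Ω) : Filter (ℕ × Ω) where
  sets := {A | Tendsto (fun n => P {ω | (n, ω) ∉ A}) atTop (𝓝 0)}
  univ_sets := by simp
  sets_of_superset {A B} hA hAB := tendsto_of_tendsto_of_tendsto_of_le_of_le tendsto_const_nhds hA
    (fun _ => zero_le) fun _ => measure_mono fun _ hω h => hω (hAB h)
  inter_sets {A B} hA hB := by
    have h : Tendsto (fun n => P {ω | (n, ω) ∉ A} + P {ω | (n, ω) ∉ B}) atTop (𝓝 0) := by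
      simpa using Tendsto.add hA hB
    refine tendsto_of_tendsto_of_tendsto_of_le_of_le tendsto_const_nhds h
      (fun _ => zero_le) fun n => (measure_mono fun ω hω => ?_).trans (measure_union_le _ _)
    simp only [Set.mem_ofPred_eq, Set.mem_inter_iff, not_and_or] at hω
    exact hω

variable {P : Measure Ω}

lemma mem_inProbability {A : Set (ℕ × Ω)} :
    A ∈ inProbability P ↔ Tendsto (fun n => P {ω | (n, ω) ∉ A}) atTop (𝓝 0) := Iff.rfl

lemma tendsto_fst_inProbability : Tendsto Prod.fst (inProbability P) atTop := by
  intro A hA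
  rw [mem_map, mem_inProbability]
  refine tendsto_const_nhds.congr' ?_
  filter_upwards [hA] with n hn
  simp [hn]

lemma tendstoInMeasure_of_tendsto_inProbability {E : Type*} [SeminormedAddCommGroup E]
    {Z : ℕ × Ω → E} (hZ : Tendsto Z (inProbability P) (𝓝 0)) :
    TendstoInMeasure P (fun n ω => Z (n, ω)) atTop 0 := by
  rw [tendstoInMeasure_iff_norm]
  intro ε hε
  have h := hZ.eventually (Metric.ball_mem_nhds 0 hε)
  simpa using mem_inProbability.1 h

/-- The exceptional sets off `T K` have small probability uniformly in n, so convergence may be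
checked on each `T K`. -/
lemma tendsto_inProbability_of_tight {E : Type*} {Z : ℕ × Ω → E} {l : Filter E}
    {T : ℝ → Set (ℕ × Ω)} (hT : ∀ δ : ℝ≥0∞, 0 < δ → ∃ K, ∀ n, P {ω | (n, ω) ∉ T K} ≤ δ)
    (hZ : ∀ K, Tendsto Z (inProbability P ⊓ 𝓟 (T K)) l) : Tendsto Z (inProbability P) l := by
  intro B hB
  rw [mem_map, mem_inProbability, ENNReal.tendsto_nhds_zero]
  intro δ hδ
  obtain ⟨K, hK⟩ := hT (δ / 2) (ENNReal.half_pos hδ.ne')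
  have h := hZ K hB
  rw [mem_map, mem_inf_principal, mem_inProbability, ENNReal.tendsto_nhds_zero] at h
  filter_upwards [h (δ / 2) (ENNReal.half_pos hδ.ne')] with n hn
  calc P {ω | (n, ω) ∉ Z ⁻¹' B}
      ≤ P ({ω | (n, ω) ∉ {x | x ∈ T K → x ∈ Z ⁻¹' B}} ∪ {ω | (n, ω) ∉ T K}) := by
        refine measure_mono fun ω hω => ?_
        by_cases h' : (n, ω) ∈ T K
        · exact Or.inl fun h'' => hω (h'' h')
        · exact Or.inr h'
    _ ≤ δ / 2 + δ / 2 := (measure_union_le _ _).trans (add_le_add hn (hK n))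
    _ = δ := ENNReal.add_halves δ

end InProbability

/-! ### Normalized sums of independent variables -/

section Sums

variable {Ω : Type*} {X : ℕ → Ω → ℝ} {μ : Measure ℝ}

/-- The sum of the first `n` values of `g (X i)`, divided by `√n`. -/
noncomputable def normalizedSum (X : ℕ → Ω → ℝ) (g : ℝ → ℝ) (n : ℕ) (ω : Ω) : ℝ :=
  (√(n : ℝ))⁻¹ * ∑ i ∈ Finset.range n, g (X i ω)

lemma normalizedSum_sub (g₁ g₂ : ℝ → ℝ) (n : ℕ) (ω : Ω) :
    normalizedSum X (fun x => g₁ x - g₂ x) n ω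
      = normalizedSum X g₁ n ω - normalizedSum X g₂ n ω := by
  simp only [normalizedSum, Finset.sum_sub_distrib, mul_sub]

lemma normalizedSum_influence (s t : ℝ) (n : ℕ) (ω : Ω) :
    normalizedSum X (influence μ s t) n ω
      = s * medianDeriv μ (fun a => normalizedSum X (fun x => bump μ x a) n ω)
        + t * madDeriv μ (fun a => normalizedSum X (fun x => bump μ x a) n ω) := by
  simp only [normalizedSum, influence_eq, Finset.sum_add_distrib, ← Finset.mul_sum, medianDeriv,
    madDeriv]
  ring

variable [MeasurableSpace Ω] {P : Measure Ω} (hX : ∀ i, HasLaw (X i) μ P)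
include hX

lemma memLp_comp {g : ℝ → ℝ} (hg : MemLp g 2 μ) (i : ℕ) : MemLp (g ∘ X i) 2 P := by
  rw [← (hX i).map_eq] at hg
  exact hg.comp_of_map (hX i).aemeasurable

lemma aemeasurable_normalizedSum {g : ℝ → ℝ} (hg : Measurable g) (n : ℕ) :
    AEMeasurable (normalizedSum X g n) P :=
  (Finset.aemeasurable_fun_sum _ fun i _ =>
    hg.comp_aemeasurable (hX i).aemeasurable).const_mul _

lemma integral_comp_eq {g : ℝ → ℝ} (hg : Measurable g) (i : ℕ) :
    ∫ ω, (g ∘ X i) ω ∂P = ∫ x, g x ∂μ :=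
  (hX i).integral_comp hg.aestronglyMeasurable

lemma variance_comp_eq {g : ℝ → ℝ} (hg : Measurable g)
    (h0 : ∫ x, g x ∂μ = 0) (i : ℕ) : Var[g ∘ X i; P] = ∫ x, g x ^ 2 ∂μ := by
  rw [variance_of_integral_eq_zero (hg.comp_aemeasurable (hX i).aemeasurable)
    ((integral_comp_eq hX hg i).trans h0)]
  exact integral_comp_eq hX (hg.pow_const 2) i

variable [IsProbabilityMeasure P] (hindep : iIndepFun X P)
include hindep

/-- Chebyshev's inequality: by independence the normalized sum has variance ∫ g² for n > 0, and 0
for n = 0. -/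
lemma measure_le_abs_normalizedSum_le {g : ℝ → ℝ} (hg : Measurable g) (hg2 : MemLp g 2 μ)
    (h0 : ∫ x, g x ∂μ = 0) (n : ℕ) {c : ℝ} (hc : 0 < c) :
    P {ω | c ≤ |normalizedSum X g n ω|} ≤ ENNReal.ofReal ((∫ x, g x ^ 2 ∂μ) / c ^ 2) := by
  have hmem i : MemLp (g ∘ X i) 2 P := memLp_comp hX hg2 i
  have hint : ∫ ω, normalizedSum X g n ω ∂P = 0 := by
    simp only [normalizedSum]
    rw [integral_const_mul, integral_finsetSum (f := fun i ω => g (X i ω)) _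
      fun i _ => (hmem i).integrable one_le_two]
    have : ∀ i, ∫ ω, g (X i ω) ∂P = 0 := fun i => (integral_comp_eq hX hg i).trans h0
    simp [this]
  have hvar : Var[normalizedSum X g n; P] ≤ ∫ x, g x ^ 2 ∂μ := by
    have h1 : normalizedSum X g n
        = fun ω => (√(n : ℝ))⁻¹ * (∑ i ∈ Finset.range n, g ∘ X i) ω := by
      ext ω
      simp [normalizedSum]
    rw [h1, variance_const_mul, IndepFun.variance_sum (fun i _ => hmem i)
      fun i _ j _ hij => (hindep.comp (fun _ => g) fun _ => hg).indepFun hij]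
    simp only [variance_comp_eq hX hg h0, Finset.sum_const, Finset.card_range, nsmul_eq_mul]
    rw [inv_pow, Real.sq_sqrt n.cast_nonneg]
    have hnn : 0 ≤ ∫ x, g x ^ 2 ∂μ := integral_nonneg fun x => sq_nonneg _
    rcases eq_or_ne (n : ℝ) 0 with hn | hn
    · simpa [hn] using hnn
    · rw [inv_mul_cancel_left₀ hn]
  have hmemS : MemLp (normalizedSum X g n) 2 P :=
    (memLp_finsetSum _ fun i _ => hmem i).const_mul _
  have h := meas_ge_le_variance_div_sq hmemS hc
  rw [hint] at h
  simp only [sub_zero] at h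
  refine h.trans (ENNReal.ofReal_le_ofReal ?_)
  gcongr

lemma tendsto_normalizedSum_inProbability {g : ℕ → ℝ → ℝ} (hg : ∀ n, Measurable (g n))
    (hg2 : ∀ n, MemLp (g n) 2 μ) (h0 : ∀ n, ∫ x, g n x ∂μ = 0)
    (hlim : Tendsto (fun n => ∫ x, g n x ^ 2 ∂μ) atTop (𝓝 0)) :
    Tendsto (fun z : ℕ × Ω => normalizedSum X (g z.1) z.1 z.2) (inProbability P) (𝓝 0) := by
  rw [Metric.tendsto_nhds]
  intro ε hε
  rw [Filter.Eventually, mem_inProbability]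
  have h1 : Tendsto (fun n => ENNReal.ofReal ((∫ x, g n x ^ 2 ∂μ) / ε ^ 2)) atTop (𝓝 0) := by
    simpa using ENNReal.tendsto_ofReal (hlim.div_const (ε ^ 2))
  refine tendsto_of_tendsto_of_tendsto_of_le_of_le tendsto_const_nhds h1
    (fun _ => zero_le) fun n => ?_
  simpa using measure_le_abs_normalizedSum_le hX hindep (hg n) (hg2 n) (h0 n) n hε

end Sums

/-! ### The empirical distribution as a local perturbation -/

section Empirical

lemma isProbabilityMeasure_empirical {n : ℕ} (hn : n ≠ 0) (x : ℕ → ℝ) :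
    IsProbabilityMeasure (empirical n x) := by
  constructor
  simp only [empirical, Measure.coe_smul, Measure.coe_finsetSum, Pi.smul_apply, Finset.sum_apply,
    measure_univ, Finset.sum_const, Finset.card_range, nsmul_eq_mul, mul_one, smul_eq_mul]
  exact ENNReal.inv_mul_cancel (by simpa using hn) (by simp)

lemma cdf_empirical {n : ℕ} (hn : n ≠ 0) (x : ℕ → ℝ) (y : ℝ) :
    cdf (empirical n x) y
      = (n : ℝ)⁻¹ * ∑ i ∈ Finset.range n, (Set.Iic y).indicator (1 : ℝ → ℝ) (x i) := by
  have := isProbabilityMeasure_empirical hn x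
  rw [cdf_eq_real, measureReal_def, empirical, Measure.smul_apply, Measure.finsetSum_apply,
    smul_eq_mul, ENNReal.toReal_mul, ENNReal.toReal_inv, ENNReal.toReal_natCast,
    ENNReal.toReal_sum fun i _ => measure_ne_top _ _]
  congr 1
  refine Finset.sum_congr rfl fun i _ => ?_
  rw [Measure.dirac_apply' _ measurableSet_Iic]
  by_cases h : x i ≤ y <;> simp [h]

lemma map_empirical {f : ℝ → ℝ} (hf : Measurable f) (n : ℕ) (x : ℕ → ℝ) :
    (empirical n x).map f = empirical n fun i => f (x i) := by
  rw [empirical, Measure.map_smul, ← Measure.mapₗ_apply_of_measurable hf, map_sum, empirical]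
  simp only [Measure.mapₗ_apply_of_measurable hf, Measure.map_dirac' hf]

lemma measurable_median_empirical (n : ℕ) : Measurable fun x : ℕ → ℝ => median (empirical n x) := by
  rcases eq_or_ne n 0 with rfl | hn
  -- For n = 0 the empirical measure is zero, whatever the sample.
  · simp [empirical]
  refine measurable_of_Iic fun y => ?_
  have : (fun x : ℕ → ℝ => median (empirical n x)) ⁻¹' Set.Iic y = {x | 1 / 2 ≤
      (n : ℝ)⁻¹ * ∑ i ∈ Finset.range n, (Set.Iic y).indicator (1 : ℝ → ℝ) (x i)} := by
    ext x
    simp only [Set.mem_preimage, Set.mem_Iic, median_le_iff, cdf_empirical hn, Set.mem_ofPred_eq]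
  rw [this]
  have hind : Measurable ((Set.Iic y).indicator (1 : ℝ → ℝ)) :=
    measurable_one.indicator measurableSet_Iic
  refine measurableSet_le measurable_const (Measurable.const_mul ?_ _)
  exact Finset.measurable_fun_sum _ fun i _ => hind.comp (measurable_pi_apply i)

lemma measurable_mad_empirical (n : ℕ) : Measurable fun x : ℕ → ℝ => mad (empirical n x) := by
  -- The MAD of a sample is the median of the sample of absolute deviations.
  have h : (fun x : ℕ → ℝ => mad (empirical n x)) = (fun x => median (empirical n x)) ∘
      fun x i => |x i - median (empirical n x)| := by
    ext x
    simp only [mad, Function.comp]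
    rw [map_empirical (by fun_prop)]
  rw [h]
  refine (measurable_median_empirical n).comp (measurable_pi_lambda _ fun i => ?_)
  exact ((measurable_pi_apply i).sub (measurable_median_empirical n)).abs

lemma measurable_rcv_empirical (n : ℕ) : Measurable fun x : ℕ → ℝ => rcv (empirical n x) :=
  ((measurable_mad_empirical n).div (measurable_median_empirical n)).const_mul _

variable {Ω : Type*} {X : ℕ → Ω → ℝ} {μ : Measure ℝ}

lemma sqrt_mul_cdf_empirical_sub {n : ℕ} (hn : n ≠ 0) (ω : Ω) (a : ℝ) :
    √(n : ℝ) * (cdf (empirical n fun i => X i ω) a - cdf μ a)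
      = normalizedSum X (fun x => bump μ x a) n ω := by
  have hs : √(n : ℝ) ≠ 0 := by positivity
  have hsq : √(n : ℝ) ^ 2 = n := Real.sq_sqrt n.cast_nonneg
  rw [cdf_empirical hn, normalizedSum]
  simp only [bump, Finset.sum_sub_distrib, Finset.sum_const, Finset.card_range, nsmul_eq_mul]
  field_simp
  rw [hsq]

variable [MeasurableSpace Ω] {P : Measure Ω} [IsProbabilityMeasure P] [IsProbabilityMeasure μ]

lemma integral_bump_sub_sq_le (a b : ℝ) :
    ∫ x, (bump μ x a - bump μ x b) ^ 2 ∂μ ≤ |cdf μ a - cdf μ b| := by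
  wlog hab : a ≤ b generalizing a b
  · have h := this b a (le_of_not_ge hab)
    rw [abs_sub_comm] at h
    simpa only [sub_sq_comm] using h
  have hexp : ∀ x, (bump μ x a - bump μ x b) ^ 2 = bump μ x a * bump μ x a
      + bump μ x b * bump μ x b - 2 * (bump μ x a * bump μ x b) := fun x => by ring
  have hi (c d : ℝ) : Integrable (fun x => bump μ x c * bump μ x d) μ :=
    integrable_bump_mul_bump c d
  simp_rw [hexp]
  rw [integral_sub (by fun_prop) (by fun_prop), integral_add (hi _ _) (hi _ _),
    integral_const_mul, integral_bump_mul_bump le_rfl, integral_bump_mul_bump le_rfl,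
    integral_bump_mul_bump hab, abs_sub_comm, abs_of_nonneg (sub_nonneg.2 (monotone_cdf μ hab))]
  -- The left side is D - D² with D = F(b) - F(a).
  nlinarith [sq_nonneg (cdf μ a - cdf μ b)]

variable (hX : ∀ i, HasLaw (X i) μ P) (hindep : iIndepFun X P)

/-- The outcomes for which the empirical process is bounded by `K` at the nodes. -/
def boundedAtNodes (X : ℕ → Ω → ℝ) (μ : Measure ℝ) (K : ℝ) : Set (ℕ × Ω) :=
  {z | ∀ a ∈ nodes μ, |normalizedSum X (fun x => bump μ x a) z.1 z.2| ≤ K}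

include hX hindep

lemma exists_measure_notMem_boundedAtNodes_le {δ : ℝ≥0∞} (hδ : 0 < δ) :
    ∃ K, ∀ n, P {ω | (n, ω) ∉ boundedAtNodes X μ K} ≤ δ := by
  -- A union bound over the three nodes, each with second moment at most 1.
  have hlim : Tendsto (fun K : ℝ => 3 * ENNReal.ofReal (1 / K ^ 2)) atTop (𝓝 0) := by
    have h1 : Tendsto (fun K : ℝ => 1 / K ^ 2) atTop (𝓝 0) :=
      tendsto_const_nhds.div_atTop (tendsto_pow_atTop two_ne_zero)
    simpa using ENNReal.Tendsto.const_mul (ENNReal.tendsto_ofReal h1) (Or.inr (by simp))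
  obtain ⟨K, hK, hK0⟩ := ((hlim.eventually_le_const hδ).and (eventually_gt_atTop 0)).exists
  refine ⟨K, fun n => ?_⟩
  have hcheb : ∀ a, P {ω | K ≤ |normalizedSum X (fun x => bump μ x a) n ω|}
      ≤ ENNReal.ofReal (1 / K ^ 2) := by
    intro a
    refine (measure_le_abs_normalizedSum_le hX hindep (measurable_bump a) (memLp_bump a 2)
      (integral_bump a) n hK0).trans (ENNReal.ofReal_le_ofReal ?_)
    gcongr
    calc ∫ x, bump μ x a ^ 2 ∂μ ≤ ∫ _, (1 : ℝ) ∂μ := by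
          refine integral_mono ((memLp_bump a 2).integrable_sq) (integrable_const _) fun x => ?_
          exact (sq_le_one_iff_abs_le_one _).2 (abs_bump_le x a)
      _ = 1 := by simp
  have hsub : {ω | (n, ω) ∉ boundedAtNodes X μ K} ⊆
      ({ω | K ≤ |normalizedSum X (fun x => bump μ x (median μ)) n ω|} ∪
      {ω | K ≤ |normalizedSum X (fun x => bump μ x (median μ - mad μ)) n ω|}) ∪
      {ω | K ≤ |normalizedSum X (fun x => bump μ x (median μ + mad μ)) n ω|} := by
    intro ω hω
    simp only [boundedAtNodes, Set.mem_ofPred_eq, not_forall, not_le] at hω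
    obtain ⟨a, ha, h⟩ := hω
    rcases ha with rfl | rfl | rfl
    exacts [Or.inl (Or.inl h.le), Or.inl (Or.inr h.le), Or.inr h.le]
  calc _ ≤ _ := (measure_mono hsub).trans ((measure_union_le _ _).trans
        (add_le_add_left (measure_union_le _ _) _))
    _ ≤ ENNReal.ofReal (1 / K ^ 2) + ENNReal.ofReal (1 / K ^ 2) + ENNReal.ofReal (1 / K ^ 2) :=
        add_le_add (add_le_add (hcheb _) (hcheb _)) (hcheb _)
    _ = 3 * ENNReal.ofReal (1 / K ^ 2) := by ring
    _ ≤ δ := hK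

/-- The error splits into an increment of the empirical process over a window shrinking to the node,
which vanishes in probability, and the difference quotient of F. Restricting to `boundedAtNodes`
supplies the boundedness. -/
lemma isLocalPerturbation_empirical (hμ : Regular μ) (K : ℝ) :
    IsLocalPerturbation μ (inProbability P ⊓ 𝓟 (boundedAtNodes X μ K))
      (fun z => (√(z.1 : ℝ))⁻¹) (fun z => empirical z.1 fun i => X i z.2)
      (fun z a => normalizedSum X (fun x => bump μ x a) z.1 z.2) := by
  have hr : Tendsto (fun n : ℕ => (√(n : ℝ))⁻¹) atTop (𝓝[>] 0) :=
    tendsto_inv_atTop_nhdsGT_zero.comp (Real.tendsto_sqrt_atTop.comp tendsto_natCast_atTop_atTop)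
  have hfst : Tendsto Prod.fst (inProbability P) atTop := tendsto_fst_inProbability
  refine ⟨(hr.comp hfst).mono_left inf_le_left, ?_, ⟨K, fun a ha => ?_⟩, fun a ha t => ?_⟩
  · filter_upwards [(hfst.mono_left inf_le_left).eventually (eventually_ne_atTop 0)] with z hz
    exact isProbabilityMeasure_empirical hz _
  · filter_upwards [mem_inf_of_right (mem_principal_self _)] with z hz using hz a ha
  · refine Tendsto.mono_left ?_ inf_le_left
    have h1 : Tendsto (fun z : ℕ × Ω => normalizedSum X
        (fun x => bump μ x (a + (√(z.1 : ℝ))⁻¹ * t) - bump μ x a) z.1 z.2)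
        (inProbability P) (𝓝 0) := by
      refine tendsto_normalizedSum_inProbability hX hindep
        (g := fun n x => bump μ x (a + (√(n : ℝ))⁻¹ * t) - bump μ x a)
        (fun n => by fun_prop) (fun n => (memLp_bump _ 2).sub (memLp_bump _ 2)) (fun n => ?_) ?_
      · rw [integral_sub (integrable_bump _) (integrable_bump _), integral_bump, integral_bump,
          sub_zero]
      · have harg : Tendsto (fun n : ℕ => a + (√(n : ℝ))⁻¹ * t) atTop (𝓝 a) := by
          simpa using ((hr.mono_right nhdsWithin_le_nhds).mul_const t).const_add a
        have hF : Tendsto (fun n : ℕ => |cdf μ (a + (√(n : ℝ))⁻¹ * t) - cdf μ a|) atTop (𝓝 0) := by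
          simpa using (((hμ.continuousAt ha).tendsto.comp harg).sub_const (cdf μ a)).abs
        exact squeeze_zero (fun n => integral_nonneg fun x => sq_nonneg _)
          (fun n => integral_bump_sub_sq_le _ _) hF
    have h2 := (tendsto_cdf_rescaled (hμ.differentiableAt ha) hr t).comp hfst
    have h3 := h1.add h2
    rw [zero_add] at h3
    refine h3.congr' ?_
    filter_upwards [hfst.eventually (eventually_ne_atTop 0)] with z hz
    rw [normalizedSum_sub, ← sqrt_mul_cdf_empirical_sub hz]
    simp only [Function.comp, div_inv_eq_mul]
    ring

lemma tendsto_median_empirical (hμ : Regular μ) :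
    Tendsto (fun z : ℕ × Ω => √(z.1 : ℝ) * (median (empirical z.1 fun i => X i z.2) - median μ)
      - normalizedSum X (influence μ 1 0) z.1 z.2) (inProbability P) (𝓝 0) := by
  refine tendsto_inProbability_of_tight
    (fun δ hδ => exists_measure_notMem_boundedAtNodes_le hX hindep hδ) fun K => ?_
  refine ((isLocalPerturbation_empirical hX hindep hμ K).tendsto_median_sub hμ).congr fun z => ?_
  rw [normalizedSum_influence, div_inv_eq_mul]
  ring

lemma tendsto_mad_empirical (hμ : Regular μ) :
    Tendsto (fun z : ℕ × Ω => √(z.1 : ℝ) * (mad (empirical z.1 fun i => X i z.2) - mad μ)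
      - normalizedSum X (influence μ 0 1) z.1 z.2) (inProbability P) (𝓝 0) := by
  refine tendsto_inProbability_of_tight
    (fun δ hδ => exists_measure_notMem_boundedAtNodes_le hX hindep hδ) fun K => ?_
  refine ((isLocalPerturbation_empirical hX hindep hμ K).tendsto_mad_sub hμ).congr fun z => ?_
  rw [normalizedSum_influence, div_inv_eq_mul]
  ring

lemma tendsto_rcv_empirical (hμ : Regular μ) (hm : median μ ≠ 0) :
    Tendsto (fun z : ℕ × Ω => √(z.1 : ℝ) * (rcv (empirical z.1 fun i => X i z.2) - rcv μ)
      - normalizedSum X (fun x => rcvDeriv μ (bump μ x)) z.1 z.2) (inProbability P) (𝓝 0) := by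
  refine tendsto_inProbability_of_tight
    (fun δ hδ => exists_measure_notMem_boundedAtNodes_le hX hindep hδ) fun K => ?_
  refine ((isLocalPerturbation_empirical hX hindep hμ K).tendsto_rcv_sub hμ hm).congr fun z => ?_
  simp_rw [rcvDeriv_bump]
  rw [normalizedSum_influence, div_inv_eq_mul, rcvDeriv]
  ring

end Empirical

/-! ### Central limit theorem for the influence sums -/

section CentralLimit

variable {Ω : Type*} [MeasurableSpace Ω] {P : Measure Ω} [IsProbabilityMeasure P]
  {X : ℕ → Ω → ℝ} {μ : Measure ℝ} (hX : ∀ i, HasLaw (X i) μ P) (hindep : iIndepFun X P)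
include hX hindep

lemma tendstoInDistribution_normalizedSum {g : ℝ → ℝ} (hg : Measurable g) (hg2 : MemLp g 2 μ)
    (h0 : ∫ x, g x ∂μ = 0) {v : ℝ} (hv : ∫ x, g x ^ 2 ∂μ = v) :
    TendstoInDistribution (normalizedSum X g) atTop id (fun _ => P)
      (gaussianReal 0 v.toNNReal) := by
  have hvar := (variance_comp_eq hX hg h0 0).trans hv
  have hY : HasLaw id (gaussianReal 0 Var[g ∘ X 0; P].toNNReal) (gaussianReal 0 v.toNNReal) := by
    rw [hvar]
    exact HasLaw.id
  have hident (i : ℕ) : IdentDistrib (g ∘ X i) (g ∘ X 0) P P :=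
    IdentDistrib.comp ⟨(hX i).aemeasurable, (hX 0).aemeasurable,
      (hX i).map_eq.trans (hX 0).map_eq.symm⟩ hg
  have h := tendstoInDistribution_inv_sqrt_mul_sum_sub (X := fun i => g ∘ X i) hY (memLp_comp hX hg2 0)
    (hindep.comp (fun _ => g) fun _ => hg) hident
  rw [integral_comp_eq hX hg 0, h0] at h
  simp only [mul_zero, sub_zero] at h
  exact h

variable [IsProbabilityMeasure μ]

/-- Cramér–Wold: the characteristic function of the pair at t is that of the scalar sum with
influence coefficients `t 0`, `t 1`, evaluated at 1. -/
lemma tendstoInDistribution_normalizedSum_pair (hμ : Regular μ) :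
    TendstoInDistribution
      (fun n ω => !₂[normalizedSum X (influence μ 1 0) n ω, normalizedSum X (influence μ 0 1) n ω])
      atTop id (fun _ => P) (multivariateGaussian 0 (Sigma μ)) := by
  have hmeas (n : ℕ) : AEMeasurable (fun ω => !₂[normalizedSum X (influence μ 1 0) n ω,
      normalizedSum X (influence μ 0 1) n ω]) P := by
    have h1 := aemeasurable_normalizedSum hX (measurable_influence (μ := μ) 1 0) n
    have h2 := aemeasurable_normalizedSum hX (measurable_influence (μ := μ) 0 1) n
    refine (WithLp.measurable_toLp 2 _).comp_aemeasurable (aemeasurable_pi_lambda _ fun i => ?_)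
    fin_cases i
    exacts [h1, h2]
  refine ⟨hmeas, by fun_prop, ProbabilityMeasure.tendsto_iff_tendsto_charFun.2 fun t => ?_⟩
  have h := ProbabilityMeasure.tendsto_iff_tendsto_charFun.1
    (tendstoInDistribution_normalizedSum hX hindep (measurable_influence (t 0) (t 1))
      (memLp_influence _ _) (integral_influence _ _) (integral_influence_sq hμ _ _)).tendsto 1
  have hlin (n : ℕ) (ω : Ω) : normalizedSum X (influence μ (t 0) (t 1)) n ω
      = t 0 * normalizedSum X (influence μ 1 0) n ω
        + t 1 * normalizedSum X (influence μ 0 1) n ω := by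
    simp only [normalizedSum_influence]
    ring
  -- Ensures that `toNNReal` does not truncate the limiting variance.
  have hnn : 0 ≤ t 0 ^ 2 * rho1 μ + 2 * t 0 * t 1 * rho12 μ + t 1 ^ 2 * rho2 μ := by
    rw [← integral_influence_sq hμ]
    exact integral_nonneg fun _ => sq_nonneg _
  simp only [ProbabilityMeasure.coe_mk, Measure.map_id] at h ⊢
  rw [charFun_gaussianReal] at h
  rw [charFun_multivariateGaussian (posSemidef_Sigma hμ)]
  convert h using 2 with n
  · rw [charFun_apply, charFun_apply, integral_map (hmeas n) (by fun_prop),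
      integral_map (aemeasurable_normalizedSum hX (measurable_influence _ _) n) (by fun_prop)]
    congr 1 with ω
    rw [hlin]
    simp [PiLp.inner_apply, Fin.sum_univ_two, mul_comm]
  · congr 1
    have hs : t.ofLp ⬝ᵥ (Sigma μ).mulVec t.ofLp
        = t 0 ^ 2 * rho1 μ + 2 * t 0 * t 1 * rho12 μ + t 1 ^ 2 * rho2 μ := by
      simp [Sigma, dotProduct, Matrix.mulVec, Fin.sum_univ_two]
      ring
    rw [hs, Real.coe_toNNReal _ hnn]
    simp

end CentralLimit

end RCVM

/-! ### The main theorem -/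

theorem mainTheorem2 {Ω : Type*} [MeasurableSpace Ω] (P : Measure Ω) [IsProbabilityMeasure P]
    (μ : Measure ℝ) [IsProbabilityMeasure μ]
    (X : ℕ → Ω → ℝ) (hX : ∀ i, HasLaw (X i) μ P) (hindep : iIndepFun X P)
    (m d v : ℝ) (hm : m = RCVM.median μ) (hd : d = RCVM.mad μ)
    (hv : v = RCVM.rcv μ ^ 2 *
      (RCVM.rho1 μ / m ^ 2 + RCVM.rho2 μ / d ^ 2 - 2 * RCVM.rho12 μ / (m * d)))
    (hcont : ∀ a ∈ ({m, m - d, m + d} : Set ℝ), ∀ᶠ x in 𝓝 a, ContinuousAt (cdf μ) x)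
    (hdiff : ∀ a ∈ ({m, m - d, m + d} : Set ℝ), DifferentiableAt ℝ (cdf μ) a)
    (hf : 0 < RCVM.dens μ m) (hC1 : 0 < RCVM.C1 μ) (hm0 : m ≠ 0) :
    -- the quotients by `d` are meaningful
    0 < d ∧
    -- joint asymptotic normality of the sample median and the sample MAD
    (RCVM.Sigma μ).PosSemidef ∧
    TendstoInDistribution
      (fun (n : ℕ) ω =>
        !₂[√(n : ℝ) * (RCVM.median (RCVM.empirical n fun i => X i ω) - m),
           √(n : ℝ) * (RCVM.mad (RCVM.empirical n fun i => X i ω) - d)])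
      atTop id (fun _ => P) (multivariateGaussian 0 (RCVM.Sigma μ)) ∧
    -- `v` is the asymptotic variance of the estimator: variance of the normal limit law
    0 ≤ v ∧
    TendstoInDistribution
      (fun (n : ℕ) ω => √(n : ℝ) * (RCVM.rcv (RCVM.empirical n fun i => X i ω) - RCVM.rcv μ))
      atTop id (fun _ => P) (gaussianReal 0 v.toNNReal) ∧
    -- and second moment of the influence function of the functional
    RCVM.HasASV RCVM.rcv μ v := by
  subst hm hd hv
  have hμ : RCVM.Regular μ :=
    ⟨hdiff _ (by simp), hdiff _ (by simp), hdiff _ (by simp), hf, hC1⟩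
  have hXm : AEMeasurable (fun ω i => X i ω) P :=
    aemeasurable_pi_lambda _ fun i => (hX i).aemeasurable
  have hmed (n : ℕ) : AEMeasurable (fun ω => √(n : ℝ) *
      (RCVM.median (RCVM.empirical n fun i => X i ω) - RCVM.median μ)) P :=
    (((RCVM.measurable_median_empirical n).comp_aemeasurable hXm).sub_const _).const_mul _
  have hmad (n : ℕ) : AEMeasurable (fun ω => √(n : ℝ) *
      (RCVM.mad (RCVM.empirical n fun i => X i ω) - RCVM.mad μ)) P :=
    (((RCVM.measurable_mad_empirical n).comp_aemeasurable hXm).sub_const _).const_mul _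
  have hrcv (n : ℕ) : AEMeasurable (fun ω => √(n : ℝ) *
      (RCVM.rcv (RCVM.empirical n fun i => X i ω) - RCVM.rcv μ)) P :=
    (((RCVM.measurable_rcv_empirical n).comp_aemeasurable hXm).sub_const _).const_mul _
  have hsq := RCVM.integral_rcvDeriv_bump_sq hμ hm0
  refine ⟨hμ.mad_pos, RCVM.posSemidef_Sigma hμ, ?_, ?_, ?_, RCVM.hasASV_rcv hμ hm0⟩
  -- Slutsky: the estimators differ from the influence sums by a term vanishing in probability.
  · refine tendstoInDistribution_of_tendstoInMeasure_sub _ _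
      (RCVM.tendstoInDistribution_normalizedSum_pair hX hindep hμ) ?_ fun n => ?_
    · have h1 := RCVM.tendsto_median_empirical hX hindep hμ
      have h2 := RCVM.tendsto_mad_empirical hX hindep hμ
      refine RCVM.tendstoInMeasure_of_tendsto_inProbability (Z := fun z : ℕ × Ω =>
        !₂[√(z.1 : ℝ) * (RCVM.median (RCVM.empirical z.1 fun i => X i z.2) - RCVM.median μ),
          √(z.1 : ℝ) * (RCVM.mad (RCVM.empirical z.1 fun i => X i z.2) - RCVM.mad μ)] -
        !₂[RCVM.normalizedSum X (RCVM.influence μ 1 0) z.1 z.2,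
          RCVM.normalizedSum X (RCVM.influence μ 0 1) z.1 z.2]) ?_
      have h3 : Tendsto (fun z : ℕ × Ω => fun i : Fin 2 => ![
          √(z.1 : ℝ) * (RCVM.median (RCVM.empirical z.1 fun i => X i z.2) - RCVM.median μ)
            - RCVM.normalizedSum X (RCVM.influence μ 1 0) z.1 z.2,
          √(z.1 : ℝ) * (RCVM.mad (RCVM.empirical z.1 fun i => X i z.2) - RCVM.mad μ)
            - RCVM.normalizedSum X (RCVM.influence μ 0 1) z.1 z.2] i)
          (RCVM.inProbability P) (𝓝 0) := by
        refine tendsto_pi_nhds.2 fun i => ?_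
        fin_cases i
        exacts [h1, h2]
      have h4 := ((PiLp.continuous_toLp 2 fun _ : Fin 2 => ℝ).tendsto 0).comp h3
      rw [WithLp.toLp_zero] at h4
      refine h4.congr fun z => ?_
      ext i
      fin_cases i <;> simp
    · refine (WithLp.measurable_toLp 2 _).comp_aemeasurable (aemeasurable_pi_lambda _ fun i => ?_)
      fin_cases i
      exacts [hmed n, hmad n]
  · rw [← hsq]
    exact integral_nonneg fun _ => sq_nonneg _
  · have hfun : (fun x => RCVM.rcvDeriv μ (RCVM.bump μ x)) = RCVM.influence μ _ _ :=
      funext RCVM.rcvDeriv_bump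
    refine tendstoInDistribution_of_tendstoInMeasure_sub _ _
      (RCVM.tendstoInDistribution_normalizedSum hX hindep
        (g := fun x => RCVM.rcvDeriv μ (RCVM.bump μ x)) ?_ ?_ ?_ hsq) ?_ hrcv
    · rw [hfun]
      exact RCVM.measurable_influence _ _
    · rw [hfun]
      exact RCVM.memLp_influence _ _
    · rw [hfun]
      exact RCVM.integral_influence _ _
    · exact RCVM.tendstoInMeasure_of_tendsto_inProbability
        (RCVM.tendsto_rcv_empirical hX hindep hμ hm0)
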